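/- Write $\lambda$ for Lebesgue measure on $\mathbb{R}$ and $|K|=\lambda(K)$. For a compact set $K\subseteq\mathbb{R}$ of positive measure put \[ \pi_K(x)=\lambda([\min K,x]\cap K),\qquad J_Kf(x)=\int_{[\min K,x]\cap K}f\,d\lambda,\qquad \|f\|_A=\sup_{x\in K}|J_Kf(x)|\qquad (x\in K,\ f\in L^\infty(K)), \] where $L^\infty(K)$ is the space of real-valued essentially bounded functions on $K$. Write $\pi_K^{-1}(t)=\{x\in K:\pi_K(x)=t\}$, and for $t\in[0,|K|]$ let $\sigma_K(t)=\min\pi_K^{-1}(t)$; let $E_K$ be the set of $t\in[0,|K|]$ for which $\pi_K^{-1}(t)$ has more than one point. Let $K,M\subseteq\mathbb{R}$ be compact sets of positive measure and let $\psi:[0,|M|]\to[0,|K|]$ be an increasing bi-Lipschitz bijection such that $K$ and $M$ are fiber $\psi$-compatible, that is, $\psi(E_M)=E_K$ and, for every $s\in E_M$, there is an increasing bijection $\pi_M^{-1}(s)\to\pi_K^{-1}(\psi(s))$. Let $\varepsilon\in\{1,-1\}$. Then: 1. There is exactly one surjective linear isometry $T:(L^\infty(K),\|\cdot\|_A)\to(L^\infty(M),\|\cdot\|_A)$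 associated to $\psi$ with sign $\varepsilon$, that is, such that $J_M(Tf)=\varepsilon\,(J_Kf)\circ\sigma_K\circ\psi\circ\pi_M$ on $M$ for every $f\in L^\infty(K)$. 2. There is an increasing homeomorphism $\phi:M\to K$ with $\pi_K\circ\phi=\psi\circ\pi_M$. 3. Every increasing homeomorphism $\phi:M\to K$ with $\pi_K\circ\phi=\psi\circ\pi_M$ agrees a.e. on $M$ with $\sigma_K\circ\psi\circ\pi_M$, and the isometry $T$ in 1 satisfies, for every $f\in L^\infty(K)$, \[ (Tf)(y)=\varepsilon\,f(\phi(y))\,\psi'(\pi_M(y))\qquad\text{for a.e. }y\in M. \] -/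

import Mathlib

open MeasureTheory Set
open scoped ENNReal

namespace Alexiewicz

noncomputable section

/-- The space `L^∞(K)` of (classes of) real-valued essentially bounded functions on `K`. -/
abbrev LInf (K : Set ℝ) : Type := Lp ℝ ∞ (volume.restrict K)

/-- The primitive `J_K f (x) = ∫_{[min K, x] ∩ K} f dλ`. -/
def J (K : Set ℝ) (f : LInf K) (x : ℝ) : ℝ := ∫ z in Icc (sInf K) x ∩ K, f z

/-- The Alexiewicz norm `‖f‖_A = sup_{x ∈ K} |J_K f (x)|`. -/
def normA (K : Set ℝ) (f : LInf K) : ℝ := ⨆ x : K, |J K f x|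

/-- The measure projection `π_K(x) = λ([min K, x] ∩ K)`; only its values on `K` matter. -/
def proj (K : Set ℝ) (x : ℝ) : ℝ := volume.real (Icc (sInf K) x ∩ K)

/-- The fiber `π_K⁻¹(t) = {x ∈ K : π_K(x) = t}`. -/
def fiber (K : Set ℝ) (t : ℝ) : Set ℝ := {x ∈ K | proj K x = t}

/-- The left-endpoint selector `σ_K(t) = min π_K⁻¹(t)`. For compact `K` of positive measure and
`t ∈ [0, |K|]` the fiber is compact and nonempty, so the infimum is a minimum. -/
def sel (K : Set ℝ) (t : ℝ) : ℝ := sInf (fiber K t)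

/-- The set `E_K` of those `t ∈ [0, |K|]` whose fiber has more than one point. -/
def E (K : Set ℝ) : Set ℝ := {t ∈ Icc 0 (volume.real K) | (fiber K t).Nontrivial}

/-- `ψ` restricts to an increasing lipeomorphism (bi-Lipschitz bijection) `[0, a] → [0, b]`.
Values of `ψ` outside `[0, a]` are irrelevant. -/
structure IsIncreasingLipeo (a b : ℝ) (ψ : ℝ → ℝ) : Prop where
  strictMonoOn : StrictMonoOn ψ (Icc 0 a)
  bijOn : BijOn ψ (Icc 0 a) (Icc 0 b)
  lipschitz : ∃ C, LipschitzOnWith C ψ (Icc 0 a)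
  lipschitz_inv : ∃ C, AntilipschitzWith C ((Icc 0 a).domRestrict ψ)

/-- `K` and `M` are fiber `ψ`-compatible: `ψ(E_M) = E_K` and corresponding fibers are
order-isomorphic. -/
def FiberCompatible (K M : Set ℝ) (ψ : ℝ → ℝ) : Prop :=
  ψ '' E M = E K ∧ ∀ s ∈ E M, Nonempty (fiber M s ≃o fiber K (ψ s))

/-- `φ` is an increasing homeomorphism `M → K` with `π_K ∘ φ = ψ ∘ π_M`. -/
def IsIncreasingLift (K M : Set ℝ) (ψ : ℝ → ℝ) (φ : M ≃ₜ K) : Prop :=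
  StrictMono φ ∧ ∀ y : M, proj K (φ y) = ψ (proj M y)

/-- `T` is a surjective linear isometry `(L^∞(K), ‖·‖_A) → (L^∞(M), ‖·‖_A)` associated to `ψ`,
with sign `ε`: `J_M (T f) = ε (J_K f) ∘ σ_K ∘ ψ ∘ π_M` on `M` for all `f`. -/
structure IsAssociatedIsometry (K M : Set ℝ) (ψ : ℝ → ℝ) (ε : ℝ)
    (T : LInf K →ₗ[ℝ] LInf M) : Prop where
  surjective : Function.Surjective T
  isometry : ∀ f, normA M (T f) = normA K f
  primitive : ∀ f, ∀ y ∈ M, J M (T f) y = ε * J K f (sel K (ψ (proj M y)))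

end

end Alexiewicz


/-!
The projection `π_K` and the selector `σ_K` form a Galois connection, so `σ_K` pushes Lebesgue
measure on `[0, |K|]` to Lebesgue measure on `K`, and `π_K` pushes it back. Hence
`J_K f(x) = ∫_0^{π_K(x)} f ∘ σ_K`: after transport to intervals the isometry is the substitution
`u = ψ(s)`, that is, `f ↦ ε (f ∘ ψ) ψ'`. Since a function is determined a.e. by its primitive, the
prescribed primitives leave only one candidate, and the operator of `ψ⁻¹` is its inverse.

A lift of `ψ` must carry the fiber of `M` over `s` onto the fiber of `K` over `ψ(s)`. It can be
glued from order isomorphisms of the fibers, continuity being automatic because compact subsets of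
`ℝ` carry their order topology; and it can differ from `σ_K ∘ ψ ∘ π_M` only over the countably many
fibers with more than one point.
-/
namespace Alexiewicz

section General

theorem orderTopology_of_compactSpace {X : Type*} [LinearOrder X] [t : TopologicalSpace X]
    [OrderClosedTopology X] [CompactSpace X] : OrderTopology X := by
  have hle : t ≤ Preorder.topology X := by
    refine le_generateFrom ?_
    rintro s ⟨a, rfl | rfl⟩
    exacts [isOpen_Ioi, isOpen_Iio]
  -- A compact topology has no strictly coarser Hausdorff topology.
  refine ⟨hle.antisymm ?_⟩
  let t' : TopologicalSpace X := Preorder.topology X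
  have : @OrderTopology X t' _ := @OrderTopology.mk X t' _ rfl
  have hT2 : @T2Space X t' := inferInstance
  have hcont : @Continuous X X t t' (Equiv.refl X) := continuous_id_iff_le.2 hle
  exact continuous_id_iff_le.1 <| @Homeomorph.continuous_invFun X X t t' <|
    @Continuous.homeoOfEquivCompactToT2 X X t t' _ hT2 _ hcont

theorem ae_eq_of_forall_setIntegral_Iic_eq {α F : Type*} [LinearOrder α] [TopologicalSpace α]
    [OrderTopology α] [SecondCountableTopology α] [Nonempty α] [MeasurableSpace α] [BorelSpace α]
    [NormedAddCommGroup F] [NormedSpace ℝ F] [CompleteSpace F] {μ : Measure α} {f g : α → F}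
    (hf : Integrable f μ) (hg : Integrable g μ)
    (h : ∀ x, ∫ z in Iic x, f z ∂μ = ∫ z in Iic x, g z ∂μ) : f =ᵐ[μ] g := by
  have tendsto_integral {u : α → F} (hu : Integrable u μ) :
      Filter.Tendsto (fun x => ∫ z in Iic x, u z ∂μ) Filter.atTop (nhds (∫ z, u z ∂μ)) :=
    (aecover_Iic Filter.tendsto_id).integral_tendsto_of_countably_generated hu
  refine hf.ae_eq_of_withDensityᵥ_eq hg (VectorMeasure.ext_of_generateFrom (range Iic) ?_
    (BorelSpace.measurable_eq.trans (borel_eq_generateFrom_Iic α)) isPiSystem_Iic ?_)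
  · rintro _ ⟨x, rfl⟩
    rw [withDensityᵥ_apply hf measurableSet_Iic, withDensityᵥ_apply hg measurableSet_Iic, h]
  · rw [withDensityᵥ_apply hf .univ, withDensityᵥ_apply hg .univ, setIntegral_univ,
      setIntegral_univ]
    exact tendsto_nhds_unique (tendsto_integral hf) (by simpa only [h] using tendsto_integral hg)

theorem volume_image_eq_zero_of_lipschitzOnWith {f : ℝ → ℝ} {s : Set ℝ} {C : NNReal}
    (hf : LipschitzOnWith C f s) (hs : volume s = 0) : volume (f '' s) = 0 := by
  have h := hf.hausdorffMeasure_image_le zero_le_one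
  rwa [ENNReal.rpow_one, hausdorffMeasure_real, hs, mul_zero, nonpos_iff_eq_zero] at h

/-- Mathlib's change of variables asks for a derivative everywhere; here one almost everywhere
suffices, because the image of the exceptional null set is null. -/
theorem setIntegral_image_eq_of_monotoneOn_of_lipschitzOnWith {F : Type*} [NormedAddCommGroup F]
    [NormedSpace ℝ F] {f f' : ℝ → ℝ} {s : Set ℝ} {C : NNReal} (hs : MeasurableSet s)
    (hmono : MonotoneOn f s) (hlip : LipschitzOnWith C f s)
    (hf' : ∀ᵐ x ∂(volume.restrict s), HasDerivWithinAt f (f' x) s x) (g : ℝ → F) :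
    ∫ x in f '' s, g x = ∫ x in s, f' x • g (f x) := by
  obtain ⟨N, hbad, hN, hN0⟩ :=
    exists_measurable_superset_of_null ((ae_restrict_iff' hs).1 hf')
  have hderiv : ∀ x ∈ s \ N, HasDerivWithinAt f (f' x) (s \ N) x := fun x hx =>
    (not_not.1 (notMem_subset hbad hx.2) hx.1).mono sdiff_subset
  have hdiff : (s \ N : Set ℝ) =ᵐ[volume] s := sdiff_null_ae_eq_self hN0
  have himage : f '' (s \ N) =ᵐ[volume] f '' s := by
    have hnull : volume (f '' (s ∩ N)) = 0 := volume_image_eq_zero_of_lipschitzOnWith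
      (hlip.mono inter_subset_left) (measure_mono_null inter_subset_right hN0)
    have hsplit : f '' (s \ N) ∪ f '' (s ∩ N) = f '' s := by
      rw [← image_union, sdiff_union_inter]
    rw [← hsplit]
    exact (union_ae_eq_left_of_ae_eq_empty (ae_eq_empty.2 hnull)).symm
  rw [← setIntegral_congr_set himage, ← setIntegral_congr_set hdiff]
  exact integral_image_eq_integral_deriv_smul_of_monotoneOn (hs.diff hN) hderiv
    (hmono.mono sdiff_subset) g

theorem memLp_top_derivWithin_of_lipschitzOnWith {F : Type*} [NormedAddCommGroup F]
    [NormedSpace ℝ F] [CompleteSpace F] {f : ℝ → F} {a b : ℝ} {C : NNReal}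
    (hf : LipschitzOnWith C f (Icc a b)) :
    MemLp (derivWithin f (Icc a b)) ∞ (volume.restrict (Icc a b)) := by
  have hderiv : deriv f =ᵐ[volume.restrict (Ioo a b)] derivWithin f (Icc a b) :=
    (ae_restrict_mem measurableSet_Ioo).mono fun x hx =>
      (derivWithin_of_mem_nhds (Icc_mem_nhds hx.1 hx.2)).symm
  rw [← restrict_Ioo_eq_restrict_Icc]
  refine MemLp.ae_eq hderiv
    (memLp_top_of_bound (stronglyMeasurable_deriv f).aestronglyMeasurable C ?_)
  filter_upwards [ae_restrict_mem measurableSet_Ioo] with x hx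
  exact norm_deriv_le_of_lipschitzOn (Icc_mem_nhds hx.1 hx.2) hf

section WeightedComp

variable {α β F : Type*} [MeasurableSpace α] [MeasurableSpace β] [NormedAddCommGroup F]
  {μ : Measure α} {ν : Measure β} {θ : α → β}

theorem memLp_top_comp_quasiMeasurePreserving {f : β → F} (hf : MemLp f ∞ ν)
    (hθ : Measure.QuasiMeasurePreserving θ μ ν) : MemLp (f ∘ θ) ∞ μ := by
  refine MemLp.comp_of_map ⟨hf.1.mono_ac hθ.absolutelyContinuous, ?_⟩ hθ.aemeasurable
  exact (eLpNormEssSup_mono_measure f hθ.absolutelyContinuous).trans_lt hf.2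

variable {𝕜 : Type*} [NormedField 𝕜] [NormedSpace 𝕜 F] {w : α → 𝕜}

/-- The weighted composition operator `f ↦ w • (f ∘ θ)` between `L^∞` spaces. -/
noncomputable def weightedComp (hθ : Measure.QuasiMeasurePreserving θ μ ν)
    (hw : MemLp w ∞ μ) : Lp F ∞ ν →ₗ[𝕜] Lp F ∞ μ where
  toFun f := ((memLp_top_comp_quasiMeasurePreserving (Lp.memLp f) hθ).smul hw).toLp
  map_add' f g := by
    rw [← MemLp.toLp_add, MemLp.toLp_eq_toLp_iff]
    filter_upwards [hθ.ae (Lp.coeFn_add f g)] with y hy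
    simp only [Pi.smul_apply', Function.comp_apply, Pi.add_apply, hy, smul_add]
  map_smul' r f := by
    rw [RingHom.id_apply, ← MemLp.toLp_const_smul, MemLp.toLp_eq_toLp_iff]
    filter_upwards [hθ.ae (Lp.coeFn_smul r f)] with y hy
    simp only [Pi.smul_apply', Pi.smul_apply, Function.comp_apply, hy, smul_comm r]

theorem coeFn_weightedComp (hθ : Measure.QuasiMeasurePreserving θ μ ν)
    (hw : MemLp w ∞ μ) (f : Lp F ∞ ν) :
    weightedComp hθ hw f =ᵐ[μ] fun y => w y • f (θ y) :=
  ((memLp_top_comp_quasiMeasurePreserving (Lp.memLp f) hθ).smul hw).coeFn_toLp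

end WeightedComp

end General

section Projection

variable {K : Set ℝ}

theorem Icc_sInf_inter (hK : BddBelow K) (x : ℝ) : Icc (sInf K) x ∩ K = Iic x ∩ K :=
  Set.ext fun _ => ⟨fun h => ⟨h.1.2, h.2⟩, fun h => ⟨⟨csInf_le hK h.2, h.1⟩, h.2⟩⟩

theorem proj_eq_real_Iic (hK : BddBelow K) (x : ℝ) :
    proj K x = (volume.restrict K).real (Iic x) := by
  rw [proj, Icc_sInf_inter hK, measureReal_restrict_apply measurableSet_Iic]

theorem J_eq_setIntegral_Iic (hK : BddBelow K) (f : LInf K) (x : ℝ) :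
    J K f x = ∫ z in Iic x, f z ∂(volume.restrict K) := by
  rw [J, Icc_sInf_inter hK, Measure.restrict_restrict measurableSet_Iic]

theorem integrable_LInf (hK : IsCompact K) (f : LInf K) : Integrable f (volume.restrict K) := by
  have := isFiniteMeasure_restrict.2 (hK.measure_ne_top (μ := volume))
  exact (Lp.memLp f).integrable le_top

theorem monotone_proj (hK : volume K ≠ ∞) : Monotone (proj K) := fun _ _ hxy =>
  measureReal_mono (inter_subset_inter_left K (Icc_subset_Icc_right hxy))
    (measure_ne_top_of_subset inter_subset_right hK)

theorem proj_mem_Icc (hK : volume K ≠ ∞) (x : ℝ) : proj K x ∈ Icc 0 (volume.real K) :=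
  ⟨measureReal_nonneg, measureReal_mono inter_subset_right hK⟩

theorem continuous_proj (hK : IsCompact K) : Continuous (proj K) := by
  refine LipschitzWith.continuous (K := 1) (LipschitzWith.of_le_add fun x y => ?_)
  have hfin : IsFiniteMeasure (volume.restrict K) := isFiniteMeasure_restrict.2 hK.measure_ne_top
  calc proj K x = (volume.restrict K).real (Iic x) := proj_eq_real_Iic hK.bddBelow x
    _ ≤ (volume.restrict K).real (Iic y ∪ Ioc y x) := measureReal_mono fun z hz =>
        (le_or_gt z y).imp id fun hyz => ⟨hyz, hz⟩
    _ ≤ (volume.restrict K).real (Iic y) + (volume.restrict K).real (Ioc y x) :=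
        measureReal_union_le _ _
    _ ≤ proj K y + volume.real (Ioc y x) := by
        rw [proj_eq_real_Iic hK.bddBelow y]
        gcongr
        exact ENNReal.toReal_mono (by simp) (Measure.restrict_le_self _)
    _ ≤ proj K y + dist x y := by
        rw [Real.volume_real_Ioc, Real.dist_eq]
        gcongr
        exact max_le (le_abs_self _) (abs_nonneg _)

theorem exists_Iic_inter_eq (hK : IsCompact K) {x : ℝ} (hx : (Iic x ∩ K).Nonempty) :
    ∃ z ∈ K, z ≤ x ∧ Iic x ∩ K = Iic z ∩ K := by
  obtain ⟨z, ⟨hzx, hzK⟩, hz⟩ := (hK.inter_left isClosed_Iic).exists_isGreatest hx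
  exact ⟨z, hzK, hzx, Subset.antisymm (fun w hw => ⟨hz hw, hw.2⟩)
    (inter_subset_inter_left K (Iic_subset_Iic.2 hzx))⟩

theorem exists_mem_fiber_le (hK : IsCompact K) (hne : K.Nonempty) {x : ℝ} (hx : sInf K ≤ x) :
    ∃ z ∈ fiber K (proj K x), z ≤ x := by
  obtain ⟨z, hzK, hzx, hz⟩ := exists_Iic_inter_eq hK ⟨sInf K, hx, hK.sInf_mem hne⟩
  refine ⟨z, ⟨hzK, ?_⟩, hzx⟩
  rw [proj, proj, Icc_sInf_inter hK.bddBelow, Icc_sInf_inter hK.bddBelow, hz]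

theorem proj_sInf (K : Set ℝ) : proj K (sInf K) = 0 := by
  rw [proj, Icc_self, measureReal_def, measure_mono_null inter_subset_left Real.volume_singleton,
    ENNReal.toReal_zero]

theorem proj_sSup (hK : IsCompact K) : proj K (sSup K) = volume.real K := by
  rw [proj, Icc_sInf_inter hK.bddBelow,
    inter_eq_right.2 (show K ⊆ Iic (sSup K) from fun _ hz => le_csSup hK.bddAbove hz)]

theorem fiber_nonempty (hK : IsCompact K) (hne : K.Nonempty) {t : ℝ}
    (ht : t ∈ Icc 0 (volume.real K)) : (fiber K t).Nonempty := by
  rw [← proj_sInf K, ← proj_sSup hK] at ht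
  obtain ⟨x, hx, rfl⟩ := intermediate_value_Icc (csInf_le_csSup hne hK.bddBelow hK.bddAbove)
    (continuous_proj hK).continuousOn ht
  obtain ⟨z, hz, -⟩ := exists_mem_fiber_le hK hne hx.1
  exact ⟨z, hz⟩

theorem isLeast_sel (hK : IsCompact K) (hne : K.Nonempty) {t : ℝ}
    (ht : t ∈ Icc 0 (volume.real K)) : IsLeast (fiber K t) (sel K t) :=
  (hK.inter_right (isClosed_singleton.preimage (continuous_proj hK))).isLeast_sInf
    (fiber_nonempty hK hne ht)

theorem sel_mem (hK : IsCompact K) (hne : K.Nonempty) {t : ℝ}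
    (ht : t ∈ Icc 0 (volume.real K)) : sel K t ∈ K :=
  (isLeast_sel hK hne ht).1.1

theorem proj_sel (hK : IsCompact K) (hne : K.Nonempty) {t : ℝ}
    (ht : t ∈ Icc 0 (volume.real K)) : proj K (sel K t) = t :=
  (isLeast_sel hK hne ht).1.2

theorem sel_le_iff (hK : IsCompact K) (hne : K.Nonempty) {t x : ℝ}
    (ht : t ∈ Icc 0 (volume.real K)) (hx : sInf K ≤ x) : sel K t ≤ x ↔ t ≤ proj K x := by
  have hmono := monotone_proj hK.measure_ne_top
  refine ⟨fun h => proj_sel hK hne ht ▸ hmono h, fun h => ?_⟩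
  obtain ⟨z, ⟨hzK, hz⟩, hzx⟩ := exists_mem_fiber_le hK hne hx
  refine le_trans ?_ hzx
  rcases h.eq_or_lt with rfl | hlt
  · exact (isLeast_sel hK hne ht).2 ⟨hzK, hz⟩
  · exact (hmono.reflect_lt (by rwa [proj_sel hK hne ht, hz])).le

theorem monotoneOn_sel (hK : IsCompact K) (hne : K.Nonempty) :
    MonotoneOn (sel K) (Icc 0 (volume.real K)) := fun _ ht _ ht' htt' =>
  (sel_le_iff hK hne ht (csInf_le hK.bddBelow (sel_mem hK hne ht'))).2
    (htt'.trans_eq (proj_sel hK hne ht').symm)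

theorem sel_preimage_Iic_inter (hK : IsCompact K) (hne : K.Nonempty) {x : ℝ}
    (hx : sInf K ≤ x) :
    sel K ⁻¹' Iic x ∩ Icc 0 (volume.real K) = Icc 0 (proj K x) := by
  ext t
  refine ⟨fun ⟨htx, ht⟩ => ⟨ht.1, (sel_le_iff hK hne ht hx).1 htx⟩, fun ht => ?_⟩
  have ht' : t ∈ Icc 0 (volume.real K) := ⟨ht.1, ht.2.trans (proj_mem_Icc hK.measure_ne_top x).2⟩
  exact ⟨(sel_le_iff hK hne ht' hx).2 ht.2, ht'⟩

theorem aemeasurable_sel (hK : IsCompact K) (hne : K.Nonempty) :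
    AEMeasurable (sel K) (volume.restrict (Icc 0 (volume.real K))) :=
  aemeasurable_restrict_of_monotoneOn measurableSet_Icc (monotoneOn_sel hK hne)

theorem map_sel (hK : IsCompact K) (hne : K.Nonempty) :
    (volume.restrict (Icc 0 (volume.real K))).map (sel K) = volume.restrict K := by
  have : IsFiniteMeasure (volume.restrict K) := isFiniteMeasure_restrict.2 hK.measure_ne_top
  refine Measure.ext_of_Iic _ _ fun x => ?_
  rw [Measure.map_apply_of_aemeasurable (aemeasurable_sel hK hne) measurableSet_Iic,
    Measure.restrict_apply' measurableSet_Icc]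
  rcases lt_or_ge x (sInf K) with hx | hx
  · have hK0 : Iic x ∩ K = ∅ := eq_empty_of_forall_notMem fun z hz =>
      (hz.1.trans_lt hx).not_ge (csInf_le hK.bddBelow hz.2)
    have hsel0 : sel K ⁻¹' Iic x ∩ Icc 0 (volume.real K) = ∅ :=
      eq_empty_of_forall_notMem fun t ht => hK0.subset ⟨ht.1, sel_mem hK hne ht.2⟩
    rw [hsel0, Measure.restrict_apply measurableSet_Iic, hK0]
  · rw [sel_preimage_Iic_inter hK hne hx, Real.volume_Icc, sub_zero,
      proj_eq_real_Iic hK.bddBelow, ofReal_measureReal]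

theorem map_proj (hK : IsCompact K) (hne : K.Nonempty) :
    (volume.restrict K).map (proj K) = volume.restrict (Icc 0 (volume.real K)) := by
  have hid : proj K ∘ sel K =ᵐ[volume.restrict (Icc 0 (volume.real K))] id :=
    (ae_restrict_mem measurableSet_Icc).mono fun t ht => proj_sel hK hne ht
  calc (volume.restrict K).map (proj K)
      = ((volume.restrict (Icc 0 (volume.real K))).map (sel K)).map (proj K) := by
        rw [map_sel hK hne]
    _ = (volume.restrict (Icc 0 (volume.real K))).map (proj K ∘ sel K) :=
        AEMeasurable.map_map_of_aemeasurable (continuous_proj hK).aemeasurable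
          (aemeasurable_sel hK hne)
    _ = volume.restrict (Icc 0 (volume.real K)) := by rw [Measure.map_congr hid, Measure.map_id]

theorem tendsto_sel_ae (hK : IsCompact K) (hne : K.Nonempty) :
    Filter.Tendsto (sel K) (ae (volume.restrict (Icc 0 (volume.real K))))
      (ae (volume.restrict K)) := by
  simpa only [map_sel hK hne] using Measure.tendsto_ae_map (aemeasurable_sel hK hne)

theorem measurePreserving_proj (hK : IsCompact K) (hne : K.Nonempty) :
    MeasurePreserving (proj K) (volume.restrict K) (volume.restrict (Icc 0 (volume.real K))) :=
  ⟨(continuous_proj hK).measurable, map_proj hK hne⟩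

theorem J_eq_setIntegral_sel (hK : IsCompact K) (f : LInf K) {x : ℝ} (hx : x ∈ K) :
    J K f x = ∫ t in Icc 0 (proj K x), f (sel K t) := by
  have hne : K.Nonempty := ⟨x, hx⟩
  have hf : AEStronglyMeasurable f ((volume.restrict (Icc 0 (volume.real K))).map (sel K)) :=
    (Lp.stronglyMeasurable f).aestronglyMeasurable
  calc J K f x
      = ∫ z in Iic x, f z ∂((volume.restrict (Icc 0 (volume.real K))).map (sel K)) := by
        rw [map_sel hK hne, J_eq_setIntegral_Iic hK.bddBelow]
    _ = ∫ t in sel K ⁻¹' Iic x, f (sel K t) ∂(volume.restrict (Icc 0 (volume.real K))) :=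
        setIntegral_map measurableSet_Iic hf (aemeasurable_sel hK hne)
    _ = ∫ t in Icc 0 (proj K x), f (sel K t) := by
        rw [Measure.restrict_restrict' measurableSet_Icc,
          sel_preimage_Iic_inter hK hne (csInf_le hK.bddBelow hx)]

theorem J_congr (hK : IsCompact K) (f : LInf K) {x y : ℝ} (hx : x ∈ K) (hy : y ∈ K)
    (h : proj K x = proj K y) : J K f x = J K f y := by
  rw [J_eq_setIntegral_sel hK f hx, J_eq_setIntegral_sel hK f hy, h]

theorem J_injective (hK : IsCompact K) :
    Function.Injective fun (f : LInf K) (x : K) => J K f x := by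
  intro f g h
  refine Lp.ext (ae_eq_of_forall_setIntegral_Iic_eq (integrable_LInf hK f)
    (integrable_LInf hK g) fun x => ?_)
  rcases (Iic x ∩ K).eq_empty_or_nonempty with hempty | hne
  · simp only [Measure.restrict_restrict measurableSet_Iic, hempty, Measure.restrict_empty,
      integral_zero_measure]
  · obtain ⟨z, hzK, -, hz⟩ := exists_Iic_inter_eq hK hne
    have hfg := congrFun h ⟨z, hzK⟩
    simpa only [J_eq_setIntegral_Iic hK.bddBelow, Measure.restrict_restrict measurableSet_Iic,
      hz] using hfg

theorem countable_E (hK : volume K ≠ ∞) : (E K).Countable := by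
  refine (monotone_proj hK).countable_setOfPred_two_preimages.mono ?_
  rintro t ⟨-, x, hx, y, hy, hne⟩
  rcases hne.lt_or_gt with h | h
  exacts [⟨x, y, h, hx.2, hy.2⟩, ⟨y, x, h, hy.2, hx.2⟩]

end Projection

namespace IsIncreasingLipeo

variable {a b : ℝ} {ψ : ℝ → ℝ}

theorem exists_inverse (hψ : IsIncreasingLipeo a b ψ) :
    ∃ χ, IsIncreasingLipeo b a χ ∧ InvOn χ ψ (Icc 0 a) (Icc 0 b) := by
  have hinv : InvOn (Function.invFunOn ψ (Icc 0 a)) ψ (Icc 0 a) (Icc 0 b) :=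
    hψ.bijOn.invOn_invFunOn
  have hbij : BijOn (Function.invFunOn ψ (Icc 0 a)) (Icc 0 b) (Icc 0 a) :=
    hψ.bijOn.symm hinv.symm
  refine ⟨_, ⟨fun s hs t ht hst => ?_, hbij, ?_, ?_⟩, hinv⟩
  · rwa [← hψ.strictMonoOn.lt_iff_lt (hbij.mapsTo hs) (hbij.mapsTo ht), hinv.2 hs, hinv.2 ht]
  · obtain ⟨C, hC⟩ := hψ.lipschitz_inv
    exact ⟨C, lipschitzOnWith_iff_restrict.2 (hC.to_rightInvOn' hbij.mapsTo hinv.2)⟩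
  · obtain ⟨C, hC⟩ := hψ.lipschitz
    refine ⟨C, fun s t => ?_⟩
    have hst := hC (hbij.mapsTo s.2) (hbij.mapsTo t.2)
    rwa [hinv.2 s.2, hinv.2 t.2] at hst

theorem image_Icc (hψ : IsIncreasingLipeo a b ψ) {t : ℝ} (ht : t ∈ Icc 0 a) :
    ψ '' Icc 0 t = Icc 0 (ψ t) := by
  have hsub : Icc 0 t ⊆ Icc 0 a := Icc_subset_Icc_right ht.2
  refine Subset.antisymm (image_subset_iff.2 fun s hs => ?_) fun u hu => ?_
  · exact ⟨(hψ.bijOn.mapsTo (hsub hs)).1, hψ.strictMonoOn.monotoneOn (hsub hs) ht hs.2⟩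
  · obtain ⟨s, hs, rfl⟩ := hψ.bijOn.surjOn ⟨hu.1, hu.2.trans (hψ.bijOn.mapsTo ht).2⟩
    exact ⟨s, ⟨hs.1, (hψ.strictMonoOn.le_iff_le hs ht).1 hu.2⟩, rfl⟩

theorem tendsto_ae (hψ : IsIncreasingLipeo a b ψ) :
    Filter.Tendsto ψ (ae (volume.restrict (Icc 0 a))) (ae (volume.restrict (Icc 0 b))) := by
  obtain ⟨χ, hχ, hinv⟩ := hψ.exists_inverse
  obtain ⟨C, hC⟩ := hχ.lipschitz
  intro p hp
  have hnull : volume (pᶜ ∩ Icc 0 b) = 0 := by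
    rwa [mem_ae_iff, Measure.restrict_apply' measurableSet_Icc] at hp
  rw [Filter.mem_map, mem_ae_iff, Measure.restrict_apply' measurableSet_Icc]
  refine measure_mono_null (fun s hs => ?_)
    (volume_image_eq_zero_of_lipschitzOnWith (hC.mono inter_subset_right) hnull)
  exact ⟨ψ s, ⟨hs.1, hψ.bijOn.mapsTo hs.2⟩, hinv.1 hs.2⟩

theorem memLp_derivWithin (hψ : IsIncreasingLipeo a b ψ) :
    MemLp (derivWithin ψ (Icc 0 a)) ∞ (volume.restrict (Icc 0 a)) :=
  hψ.lipschitz.elim fun _ hC => memLp_top_derivWithin_of_lipschitzOnWith hC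

theorem setIntegral_Icc_eq (hψ : IsIncreasingLipeo a b ψ) {t : ℝ} (ht : t ∈ Icc 0 a)
    (g : ℝ → ℝ) :
    ∫ u in Icc 0 (ψ t), g u = ∫ s in Icc 0 t, derivWithin ψ (Icc 0 a) s * g (ψ s) := by
  obtain ⟨C, hC⟩ := hψ.lipschitz
  have hsub : Icc 0 t ⊆ Icc 0 a := Icc_subset_Icc_right ht.2
  have hmono : MonotoneOn ψ (Icc 0 a) := hψ.strictMonoOn.monotoneOn
  rw [← hψ.image_Icc ht]
  refine setIntegral_image_eq_of_monotoneOn_of_lipschitzOnWith measurableSet_Icc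
    (hmono.mono hsub) (hC.mono hsub) ?_ g
  filter_upwards [ae_restrict_of_ae_restrict_of_subset hsub
    (hmono.ae_differentiableWithinAt measurableSet_Icc)] with s hs
  exact hs.hasDerivWithinAt.mono hsub

end IsIncreasingLipeo

section Transport

variable {K M : Set ℝ} {ψ : ℝ → ℝ}

/-- The map `σ_K ∘ ψ ∘ π_M`, extended to the whole line, that plays the role of a lift of `ψ`
to a map `M → K`. -/
noncomputable def transport (K M : Set ℝ) (ψ : ℝ → ℝ) (y : ℝ) : ℝ := sel K (ψ (proj M y))

theorem transport_mem (hK : IsCompact K) (hne : K.Nonempty) (hM : volume M ≠ ∞)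
    (hψ : IsIncreasingLipeo (volume.real M) (volume.real K) ψ) (y : ℝ) : transport K M ψ y ∈ K :=
  sel_mem hK hne (hψ.bijOn.mapsTo (proj_mem_Icc hM y))

theorem proj_transport (hK : IsCompact K) (hne : K.Nonempty) (hM : volume M ≠ ∞)
    (hψ : IsIncreasingLipeo (volume.real M) (volume.real K) ψ) (y : ℝ) :
    proj K (transport K M ψ y) = ψ (proj M y) :=
  proj_sel hK hne (hψ.bijOn.mapsTo (proj_mem_Icc hM y))

theorem monotone_transport (hK : IsCompact K) (hne : K.Nonempty) (hM : volume M ≠ ∞)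
    (hψ : IsIncreasingLipeo (volume.real M) (volume.real K) ψ) : Monotone (transport K M ψ) :=
  fun y y' h => monotoneOn_sel hK hne (hψ.bijOn.mapsTo (proj_mem_Icc hM y))
    (hψ.bijOn.mapsTo (proj_mem_Icc hM y'))
    (hψ.strictMonoOn.monotoneOn (proj_mem_Icc hM y) (proj_mem_Icc hM y') (monotone_proj hM h))

theorem tendsto_comp_proj_ae (hM : IsCompact M) (hMne : M.Nonempty) {b : ℝ}
    (hψ : IsIncreasingLipeo (volume.real M) b ψ) :
    Filter.Tendsto (fun y => ψ (proj M y)) (ae (volume.restrict M))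
      (ae (volume.restrict (Icc 0 b))) :=
  hψ.tendsto_ae.comp (measurePreserving_proj hM hMne).quasiMeasurePreserving.tendsto_ae

theorem quasiMeasurePreserving_transport (hK : IsCompact K) (hKne : K.Nonempty)
    (hM : IsCompact M) (hMne : M.Nonempty)
    (hψ : IsIncreasingLipeo (volume.real M) (volume.real K) ψ) :
    Measure.QuasiMeasurePreserving (transport K M ψ) (volume.restrict M) (volume.restrict K) := by
  have hmeas : Measurable (transport K M ψ) :=
    (monotone_transport hK hKne hM.measure_ne_top hψ).measurable
  have htendsto : Filter.Tendsto (transport K M ψ) (ae (volume.restrict M))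
      (ae (volume.restrict K)) :=
    (tendsto_sel_ae hK hKne).comp (tendsto_comp_proj_ae hM hMne hψ)
  refine ⟨hmeas, .mk fun s hs hs0 => ?_⟩
  rw [Measure.map_apply hmeas hs]
  exact compl_mem_ae_iff.1 (htendsto (compl_mem_ae_iff.2 hs0))

theorem memLp_derivWithin_comp_proj (hM : IsCompact M) (hne : M.Nonempty) {b : ℝ}
    (hψ : IsIncreasingLipeo (volume.real M) b ψ) :
    MemLp (fun y => derivWithin ψ (Icc 0 (volume.real M)) (proj M y)) ∞ (volume.restrict M) :=
  hψ.memLp_derivWithin.comp_measurePreserving (measurePreserving_proj hM hne)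

/-- The candidate isometry `f ↦ ε (ψ' ∘ π_M) (f ∘ σ_K ∘ ψ ∘ π_M)` associated to `ψ` with
sign `ε`. -/
noncomputable def transportOp (hK : IsCompact K) (hKne : K.Nonempty) (hM : IsCompact M)
    (hMne : M.Nonempty) (hψ : IsIncreasingLipeo (volume.real M) (volume.real K) ψ) (ε : ℝ) :
    LInf K →ₗ[ℝ] LInf M :=
  weightedComp (quasiMeasurePreserving_transport hK hKne hM hMne hψ)
    ((memLp_derivWithin_comp_proj hM hMne hψ).const_mul ε)

theorem coeFn_transportOp (hK : IsCompact K) (hKne : K.Nonempty) (hM : IsCompact M)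
    (hMne : M.Nonempty) (hψ : IsIncreasingLipeo (volume.real M) (volume.real K) ψ) (ε : ℝ)
    (f : LInf K) :
    transportOp hK hKne hM hMne hψ ε f =ᵐ[volume.restrict M] fun y =>
      ε * derivWithin ψ (Icc 0 (volume.real M)) (proj M y) * f (transport K M ψ y) :=
  coeFn_weightedComp _ _ f

theorem J_transportOp (hK : IsCompact K) (hKne : K.Nonempty) (hM : IsCompact M)
    (hMne : M.Nonempty) (hψ : IsIncreasingLipeo (volume.real M) (volume.real K) ψ) (ε : ℝ)
    (f : LInf K) {y : ℝ} (hy : y ∈ M) :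
    J M (transportOp hK hKne hM hMne hψ ε f) y = ε * J K f (transport K M ψ y) := by
  have hMfin : volume M ≠ ∞ := hM.measure_ne_top
  have hsub : Icc 0 (proj M y) ⊆ Icc 0 (volume.real M) :=
    Icc_subset_Icc_right (proj_mem_Icc hMfin y).2
  have hTf : ∀ᵐ s ∂(volume.restrict (Icc 0 (proj M y))),
      transportOp hK hKne hM hMne hψ ε f (sel M s) =
        ε * (derivWithin ψ (Icc 0 (volume.real M)) s * f (sel K (ψ s))) := by
    refine ae_restrict_of_ae_restrict_of_subset hsub ?_
    filter_upwards [(tendsto_sel_ae hM hMne).eventually (coeFn_transportOp hK hKne hM hMne hψ ε f),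
      ae_restrict_mem measurableSet_Icc] with s hs hsI
    rw [hs, transport, proj_sel hM hMne hsI, mul_assoc]
  calc J M (transportOp hK hKne hM hMne hψ ε f) y
      = ∫ s in Icc 0 (proj M y), transportOp hK hKne hM hMne hψ ε f (sel M s) :=
        J_eq_setIntegral_sel hM _ hy
    _ = ε * ∫ s in Icc 0 (proj M y),
          derivWithin ψ (Icc 0 (volume.real M)) s * f (sel K (ψ s)) := by
        rw [integral_congr_ae hTf, integral_const_mul]
    _ = ε * ∫ t in Icc 0 (ψ (proj M y)), f (sel K t) := by
        rw [hψ.setIntegral_Icc_eq (proj_mem_Icc hMfin y) fun t => f (sel K t)]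
    _ = ε * J K f (transport K M ψ y) := by
        rw [J_eq_setIntegral_sel hK f (transport_mem hK hKne hMfin hψ y),
          proj_transport hK hKne hMfin hψ y]

theorem exists_J_transport_eq (hK : IsCompact K) (hM : IsCompact M) (hMne : M.Nonempty)
    (hψ : IsIncreasingLipeo (volume.real M) (volume.real K) ψ) {x : ℝ} (hx : x ∈ K) :
    ∃ y ∈ M, ∀ f, J K f (transport K M ψ y) = J K f x := by
  obtain ⟨s, hs, hsx⟩ := hψ.bijOn.surjOn (proj_mem_Icc hK.measure_ne_top x)
  have hMfin : volume M ≠ ∞ := hM.measure_ne_top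
  refine ⟨sel M s, sel_mem hM hMne hs, fun f =>
    J_congr hK f (transport_mem hK ⟨x, hx⟩ hMfin hψ _) hx ?_⟩
  rw [proj_transport hK ⟨x, hx⟩ hMfin hψ, proj_sel hM hMne hs, hsx]

theorem normA_eq_of_primitive (hK : IsCompact K) (hKne : K.Nonempty) (hM : IsCompact M)
    (hMne : M.Nonempty) (hψ : IsIncreasingLipeo (volume.real M) (volume.real K) ψ) {ε : ℝ}
    (hε : |ε| = 1) {f : LInf K} {g : LInf M}
    (h : ∀ y ∈ M, J M g y = ε * J K f (transport K M ψ y)) : normA M g = normA K f := by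
  have habs : ∀ y ∈ M, |J M g y| = |J K f (transport K M ψ y)| := fun y hy => by
    rw [h y hy, abs_mul, hε, one_mul]
  have hrange : range (fun y : M => |J M g y|) = range fun x : K => |J K f x| := by
    refine Subset.antisymm (range_subset_iff.2 fun y => ?_) (range_subset_iff.2 fun x => ?_)
    · exact ⟨⟨_, transport_mem hK hKne hM.measure_ne_top hψ y⟩, (habs y y.2).symm⟩
    · obtain ⟨y, hy, hyx⟩ := exists_J_transport_eq hK hM hMne hψ x.2
      exact ⟨⟨y, hy⟩, (habs y hy).trans (congrArg abs (hyx f))⟩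
  exact congrArg sSup hrange

theorem surjective_transportOp (hK : IsCompact K) (hKne : K.Nonempty) (hM : IsCompact M)
    (hMne : M.Nonempty) (hψ : IsIncreasingLipeo (volume.real M) (volume.real K) ψ) {ε : ℝ}
    (hε : ε * ε = 1) : Function.Surjective (transportOp hK hKne hM hMne hψ ε) := by
  obtain ⟨χ, hχ, hinv⟩ := hψ.exists_inverse
  have hMfin : volume M ≠ ∞ := hM.measure_ne_top
  have hKfin : volume K ≠ ∞ := hK.measure_ne_top
  refine fun g => ⟨transportOp hM hMne hK hKne hχ ε g, J_injective hM (funext fun y => ?_)⟩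
  have hyK : transport K M ψ y ∈ K := transport_mem hK hKne hMfin hψ y
  have hproj : proj M (transport M K χ (transport K M ψ y)) = proj M y := by
    rw [proj_transport hM hMne hKfin hχ, proj_transport hK hKne hMfin hψ,
      hinv.1 (proj_mem_Icc hMfin y)]
  beta_reduce
  rw [J_transportOp hK hKne hM hMne hψ ε _ y.2, J_transportOp hM hMne hK hKne hχ ε g hyK,
    ← mul_assoc, hε, one_mul]
  exact J_congr hM g (transport_mem hM hMne hKfin hχ _) y.2 hproj

theorem isAssociatedIsometry_transportOp (hK : IsCompact K) (hKne : K.Nonempty)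
    (hM : IsCompact M) (hMne : M.Nonempty)
    (hψ : IsIncreasingLipeo (volume.real M) (volume.real K) ψ) {ε : ℝ} (hε : |ε| = 1) :
    IsAssociatedIsometry K M ψ ε (transportOp hK hKne hM hMne hψ ε) where
  surjective := surjective_transportOp hK hKne hM hMne hψ (by rw [← abs_mul_abs_self, hε, one_mul])
  isometry f := normA_eq_of_primitive hK hKne hM hMne hψ hε fun _ =>
    J_transportOp hK hKne hM hMne hψ ε f
  primitive f _ := J_transportOp hK hKne hM hMne hψ ε f

theorem IsAssociatedIsometry.unique (hM : IsCompact M) {ε : ℝ} {T T' : LInf K →ₗ[ℝ] LInf M}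
    (hT : IsAssociatedIsometry K M ψ ε T) (hT' : IsAssociatedIsometry K M ψ ε T') : T = T' :=
  LinearMap.ext fun f => J_injective hM <| funext fun y =>
    (hT.primitive f y y.2).trans (hT'.primitive f y y.2).symm

end Transport

section Lift

variable {K M : Set ℝ} {ψ : ℝ → ℝ}

theorem ae_lift_eq_sel (hK : IsCompact K) (hKne : K.Nonempty) (hM : IsCompact M)
    (hψ : IsIncreasingLipeo (volume.real M) (volume.real K) ψ) {φ : M → K}
    (hφ : ∀ y, proj K (φ y) = ψ (proj M y)) :
    ∀ᵐ y, ∀ hy : y ∈ M, (φ ⟨y, hy⟩ : ℝ) = transport K M ψ y := by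
  rcases M.eq_empty_or_nonempty with rfl | hMne
  · exact .of_forall fun _ hy => hy.elim
  have hE : ∀ᵐ y ∂(volume.restrict M), ψ (proj M y) ∉ E K :=
    (tendsto_comp_proj_ae hM hMne hψ).eventually
      ((countable_E hK.measure_ne_top).ae_notMem _)
  filter_upwards [(ae_restrict_iff' hM.measurableSet).1 hE] with y hyE hy
  have hψy := hψ.bijOn.mapsTo (proj_mem_Icc hM.measure_ne_top y)
  have hsub : (fiber K (ψ (proj M y))).Subsingleton :=
    not_nontrivial_iff.1 fun h => hyE hy ⟨hψy, h⟩
  exact hsub ⟨(φ ⟨y, hy⟩).2, hφ ⟨y, hy⟩⟩ (isLeast_sel hK hKne hψy).1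

theorem nonempty_fiber_orderIso (hK : IsCompact K) (hKne : K.Nonempty) (hM : IsCompact M)
    (hMne : M.Nonempty) (hψ : IsIncreasingLipeo (volume.real M) (volume.real K) ψ)
    (hc : FiberCompatible K M ψ) {s : ℝ} (hs : s ∈ Icc 0 (volume.real M)) :
    Nonempty (fiber M s ≃o fiber K (ψ s)) := by
  by_cases hsE : s ∈ E M
  · exact hc.2 s hsE
  have hψs := hψ.bijOn.mapsTo hs
  have hψsE : ψ s ∉ E K := by
    rw [← hc.1]
    rintro ⟨s', hs', h⟩
    exact hsE (hψ.bijOn.injOn hs'.1 hs h ▸ hs')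
  have unique_fiber {L : Set ℝ} {t : ℝ} (ht : t ∈ Icc 0 (volume.real L)) (htE : t ∉ E L)
      (hne : (fiber L t).Nonempty) : Nonempty (Unique (fiber L t)) :=
    hne.elim fun x hx => ⟨⟨⟨x, hx⟩⟩, fun z =>
      Subtype.ext (not_nontrivial_iff.1 (fun h => htE ⟨ht, h⟩) z.2 hx)⟩
  obtain ⟨_⟩ := unique_fiber hs hsE (fiber_nonempty hM hMne hs)
  obtain ⟨_⟩ := unique_fiber hψs hψsE (fiber_nonempty hK hKne hψs)
  exact ⟨.ofUnique _ _⟩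

/-- The map `M → K` glued from order isomorphisms between corresponding fibers. -/
noncomputable def glueFibers (hM : volume M ≠ ∞)
    (e : ∀ s : Icc 0 (volume.real M), fiber M s ≃o fiber K (ψ s)) (y : M) : K :=
  inclusion (fun _ h => h.1) (e ⟨proj M y, proj_mem_Icc hM y⟩ ⟨y, y.2, rfl⟩)

variable {e : ∀ s : Icc 0 (volume.real M), fiber M s ≃o fiber K (ψ s)}

theorem glueFibers_apply (hM : volume M ≠ ∞) {s : Icc 0 (volume.real M)} {y : M}
    (hy : proj M y = s) : (glueFibers hM e y : ℝ) = e s ⟨y, y.2, hy⟩ := by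
  obtain rfl : ⟨proj M y, proj_mem_Icc hM y⟩ = s := Subtype.ext hy
  rfl

theorem proj_glueFibers (hM : volume M ≠ ∞) (y : M) :
    proj K (glueFibers hM e y) = ψ (proj M y) :=
  (e ⟨proj M y, proj_mem_Icc hM y⟩ ⟨y, y.2, rfl⟩).2.2

theorem strictMono_glueFibers (hK : volume K ≠ ∞) (hM : volume M ≠ ∞)
    (hψ : StrictMonoOn ψ (Icc 0 (volume.real M))) : StrictMono (glueFibers hM e) := by
  intro y y' hlt
  rcases (monotone_proj hM (Subtype.coe_lt_coe.2 hlt).le).lt_or_eq with h | h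
  · have hproj := hψ (proj_mem_Icc hM y) (proj_mem_Icc hM y') h
    rw [← proj_glueFibers (e := e) hM, ← proj_glueFibers (e := e) hM] at hproj
    exact Subtype.coe_lt_coe.1 ((monotone_proj hK).reflect_lt hproj)
  · let s : Icc 0 (volume.real M) := ⟨proj M y', proj_mem_Icc hM y'⟩
    rw [← Subtype.coe_lt_coe, glueFibers_apply (s := s) hM h, glueFibers_apply (s := s) hM rfl,
      Subtype.coe_lt_coe, OrderIso.lt_iff_lt]
    exact hlt

theorem surjective_glueFibers (hK : volume K ≠ ∞) (hM : volume M ≠ ∞)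
    (hψ : SurjOn ψ (Icc 0 (volume.real M)) (Icc 0 (volume.real K))) :
    Function.Surjective (glueFibers hM e) := by
  rintro ⟨x, hx⟩
  obtain ⟨s, hs, hsx⟩ := hψ (proj_mem_Icc hK x)
  let y := (e ⟨s, hs⟩).symm ⟨x, hx, hsx.symm⟩
  refine ⟨⟨y, y.2.1⟩, Subtype.ext ?_⟩
  rw [glueFibers_apply (s := ⟨s, hs⟩) hM y.2.2]
  exact congrArg Subtype.val ((e ⟨s, hs⟩).apply_symm_apply ⟨x, hx, hsx.symm⟩)

theorem exists_isIncreasingLift (hK : IsCompact K) (hKne : K.Nonempty) (hM : IsCompact M)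
    (hMne : M.Nonempty) (hψ : IsIncreasingLipeo (volume.real M) (volume.real K) ψ)
    (hc : FiberCompatible K M ψ) : ∃ φ : M ≃ₜ K, IsIncreasingLift K M ψ φ := by
  have hKfin : volume K ≠ ∞ := hK.measure_ne_top
  have hMfin : volume M ≠ ∞ := hM.measure_ne_top
  let e := fun s : Icc 0 (volume.real M) =>
    (nonempty_fiber_orderIso hK hKne hM hMne hψ hc s.2).some
  have hmono : StrictMono (glueFibers hMfin e) :=
    strictMono_glueFibers hKfin hMfin hψ.strictMonoOn
  have hsurj : Function.Surjective (glueFibers hMfin e) :=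
    surjective_glueFibers hKfin hMfin hψ.bijOn.surjOn
  have : CompactSpace K := isCompact_iff_compactSpace.1 hK
  have : CompactSpace M := isCompact_iff_compactSpace.1 hM
  have : OrderTopology K := orderTopology_of_compactSpace
  have : OrderTopology M := orderTopology_of_compactSpace
  exact ⟨(hmono.orderIsoOfSurjective _ hsurj).toHomeomorph, hmono, proj_glueFibers hMfin⟩

end Lift

end Alexiewicz

theorem corollary4p7 (K M : Set ℝ) (hK : IsCompact K) (hM : IsCompact M)
    (hK0 : 0 < volume K) (hM0 : 0 < volume M) (ψ : ℝ → ℝ)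
    (hψ : Alexiewicz.IsIncreasingLipeo (volume.real M) (volume.real K) ψ)
    (hc : Alexiewicz.FiberCompatible K M ψ) (ε : ℝ) (hε : ε = 1 ∨ ε = -1) :
    (∃! T : Alexiewicz.LInf K →ₗ[ℝ] Alexiewicz.LInf M,
      Alexiewicz.IsAssociatedIsometry K M ψ ε T) ∧
    (∃ φ : M ≃ₜ K, Alexiewicz.IsIncreasingLift K M ψ φ) ∧
    (∀ φ : M ≃ₜ K, Alexiewicz.IsIncreasingLift K M ψ φ →
      (∀ᵐ y ∂(volume : Measure ℝ), ∀ hy : y ∈ M,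
        (φ ⟨y, hy⟩ : ℝ) = Alexiewicz.sel K (ψ (Alexiewicz.proj M y))) ∧
      ∀ T : Alexiewicz.LInf K →ₗ[ℝ] Alexiewicz.LInf M,
        Alexiewicz.IsAssociatedIsometry K M ψ ε T →
        ∀ f : Alexiewicz.LInf K, ∀ᵐ y ∂(volume : Measure ℝ), ∀ hy : y ∈ M,
          T f y = ε * f (φ ⟨y, hy⟩ : ℝ) *
            derivWithin ψ (Icc 0 (volume.real M)) (Alexiewicz.proj M y)) := by
  have hKne : K.Nonempty := nonempty_of_measure_ne_zero hK0.ne'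
  have hMne : M.Nonempty := nonempty_of_measure_ne_zero hM0.ne'
  have hε1 : |ε| = 1 := by rcases hε with rfl | rfl <;> simp
  have hT₀ := Alexiewicz.isAssociatedIsometry_transportOp hK hKne hM hMne hψ hε1
  refine ⟨⟨_, hT₀, fun T hT => hT.unique hM hT₀⟩,
    Alexiewicz.exists_isIncreasingLift hK hKne hM hMne hψ hc, fun φ hφ => ?_⟩
  have hlift := Alexiewicz.ae_lift_eq_sel hK hKne hM hψ hφ.2
  refine ⟨hlift, fun T hT f => ?_⟩
  obtain rfl := hT.unique hM hT₀
  have hTf := (ae_restrict_iff' hM.measurableSet).1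
    (Alexiewicz.coeFn_transportOp hK hKne hM hMne hψ ε f)
  filter_upwards [hlift, hTf] with y hφy hTy hy
  rw [hTy hy, hφy hy, mul_right_comm]
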